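/- Let $\varphi(z)=\frac1{\sqrt{2\pi}}e^{-z^2/2}$ and $G(z)=\int_z^{\infty}\varphi(w)\,dw$ for $z\in\mathbb{C}$ be the entire functions extending the density and the tail function of the standard normal distribution (the upper limit of the integral is the point $\infty=\infty+0i$ of the extended real axis; the integral does not depend on the contour, and one may integrate along the segment from $z$ to $0$ and then along $[0,\infty)$). Let $R=\varphi/G$ be the inverse Mills ratio and let $H_+=\{z\in\mathbb{C}:\operatorname{Re}z\ge0\}$. Then $G$ has no zeros on $H_+$, so that $R$ is defined there, and for all $z\in H_+\setminus\{0\}$ $$|R(z)|<\Big|z+\sqrt{2/\pi}\Big|,$$ whereas $R(0)=\sqrt{2/\pi}$. Moreover, $R(z)\sim z$ as $z\to\infty$ within $H_+$; that is, $R(z)/z\to1$ as $|z|\to\infty$, $z\in H_+$. -/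

import Mathlib

namespace InverseMills

/-- The standard normal density `φ(z) = e^{-z²/2} / √(2π)`, as an entire function. -/
noncomputable def phi (z : ℂ) : ℂ :=
  ((1 / Real.sqrt (2 * Real.pi) : ℝ) : ℂ) * Complex.exp (-z ^ 2 / 2)

/-- The standard normal tail `G(z) = ∫_z^∞ φ(w) dw`, where `∞ = ∞ + 0i`, as an entire function:
the contour is the segment from `z` to `0` followed by the positive real half-axis, and the
integral of `φ` over the segment from `0` to `z` is `z ∫_0^1 φ(t z) dt`. -/
noncomputable def tail (z : ℂ) : ℂ :=
  (∫ u in Set.Ioi (0 : ℝ), phi (u : ℂ)) - z * ∫ t in (0 : ℝ)..1, phi ((t : ℂ) * z)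

/-- The inverse Mills ratio `R = φ / G`. -/
noncomputable def R (z : ℂ) : ℂ := phi z / tail z

/-- The closed right half-plane `{z : Re z ≥ 0}`. -/
def rightHalfPlane : Set ℂ := {z : ℂ | 0 ≤ z.re}

theorem phi_ofReal (x : ℝ) : phi (x : ℂ) = ((ProbabilityTheory.gaussianPDFReal 0 1 x : ℝ) : ℂ) := by
  simp [phi, ProbabilityTheory.gaussianPDFReal]

theorem differentiable_phi : Differentiable ℂ phi := by
  unfold phi
  fun_prop

theorem integrable_phi_ofReal : MeasureTheory.Integrable (fun x : ℝ => phi (x : ℂ)) := by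
  simp only [phi_ofReal]
  exact (ProbabilityTheory.integrable_gaussianPDFReal 0 1).ofReal

/-- On the real line, `tail` is the tail integral of the density. -/
theorem tail_ofReal (x : ℝ) : tail (x : ℂ) = ∫ u in Set.Ioi x, phi (u : ℂ) := by
  have h1 : (x : ℂ) * ∫ t in (0 : ℝ)..1, phi ((t : ℂ) * (x : ℂ))
      = ∫ u in (0 : ℝ)..x, phi (u : ℂ) := by
    have h := intervalIntegral.smul_integral_comp_mul_right (a := 0) (b := 1)
      (fun u : ℝ => phi (u : ℂ)) x
    simpa using h
  have h2 := intervalIntegral.integral_Ioi_sub_Ioi'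
    (integrable_phi_ofReal.integrableOn (s := Set.Ioi 0))
    (integrable_phi_ofReal.integrableOn (s := Set.Ioi x))
  rw [tail, h1, ← h2]
  ring

/-- `tail` is an antiderivative of `-phi` on the whole plane; in particular it is entire. -/
theorem hasDerivAt_tail (z : ℂ) : HasDerivAt tail (-phi z) z := by
  obtain ⟨F, hF⟩ := (differentiable_phi.differentiableOn
    (s := Metric.ball (0 : ℂ) (‖z‖ + 1))).isExactOn_ball
  have key : ∀ w ∈ Metric.ball (0 : ℂ) (‖z‖ + 1),
      tail w = (∫ u in Set.Ioi (0 : ℝ), phi (u : ℂ)) - (F w - F 0) := by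
    intro w hw
    have hmem : ∀ t ∈ Set.Icc (0 : ℝ) 1, (0 : ℂ) + t • w ∈ Metric.ball (0 : ℂ) (‖z‖ + 1) := by
      intro t ht
      rw [mem_ball_zero_iff] at hw ⊢
      rw [zero_add, norm_smul, Real.norm_of_nonneg ht.1]
      nlinarith [ht.2, norm_nonneg w]
    have h := intervalIntegral.integral_unitInterval_deriv_eq_sub (𝕜 := ℂ) (f := F) (f' := phi)
      (z₀ := 0) (z₁ := w) (by
        have : Continuous phi := differentiable_phi.continuous
        fun_prop) (fun t ht => hF _ (hmem t ht))
    simp only [zero_add, smul_eq_mul, Complex.real_smul] at h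
    rw [tail, h]
  have hz : z ∈ Metric.ball (0 : ℂ) (‖z‖ + 1) := by simp
  have hd := ((hF z hz).sub_const (F 0)).const_sub (∫ u in Set.Ioi (0 : ℝ), phi (u : ℂ))
  refine hd.congr_of_eventuallyEq ?_
  filter_upwards [Metric.isOpen_ball.mem_nhds hz] with w hw using key w hw

end InverseMills

open MeasureTheory Filter Topology Set

namespace InverseMills

/-! Completing the square gives `tail z = phi z * moment 0 z` (`tail_eq`), so `R = 1 / moment 0`.
Each claim on the half-plane then reduces to the imaginary axis, where `phi` is real and positive
and `tail` has real part 1/2. Nonvanishing: `moment 0` is bounded on the half-plane and has positive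
real part on the axis; Phragmén–Lindelöf for `exp (-moment 0)` carries this positivity inside.
Asymptotics: integration by parts gives `z * moment 0 z = 1 - moment 1 z`, and one more gives
`moment 1 z = O(1/|z|)`. Inequality: with `c = √(2/π)`, the quotient `R z / (z + c)` is bounded near
infinity by the asymptotics and has modulus at most 1 on the axis, strictly off 0, by
`exp_sq_half_lt` and a perfect square; `norm_lt_one_of_bounded` finishes. -/

/-! ### Half-line moments: differentiation and integration by parts -/

/-- The integrand `t^k e^{-zt - t²/2}` of the half-line moments. -/
noncomputable def momentIntegrand (k : ℕ) (z : ℂ) (t : ℝ) : ℂ :=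
  (t : ℂ) ^ k * Complex.exp (-z * t - (t : ℂ) ^ 2 / 2)

/-- The half-line moment `∫_0^∞ t^k e^{-zt - t²/2} dt`; for `k = 0` this is the Mills ratio. -/
noncomputable def moment (k : ℕ) (z : ℂ) : ℂ := ∫ t in Ioi (0 : ℝ), momentIntegrand k z t

theorem continuous_momentIntegrand (k : ℕ) (z : ℂ) : Continuous (momentIntegrand k z) := by
  unfold momentIntegrand
  fun_prop

theorem norm_momentIntegrand (k : ℕ) (z : ℂ) (t : ℝ) :
    ‖momentIntegrand k z t‖ = |t| ^ k * Real.exp (-z.re * t - t ^ 2 / 2) := by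
  have : (-z * t - (t : ℂ) ^ 2 / 2).re = -z.re * t - t ^ 2 / 2 := by
    have : -z * t - (t : ℂ) ^ 2 / 2 = -z * t - ((t ^ 2 / 2 : ℝ) : ℂ) := by push_cast; rfl
    rw [this, Complex.sub_re, Complex.re_mul_ofReal, Complex.ofReal_re, Complex.neg_re]
  rw [momentIntegrand, norm_mul, Complex.norm_exp, norm_pow, Complex.norm_real, this,
    Real.norm_eq_abs]

theorem norm_momentIntegrand_le (k : ℕ) {z w : ℂ} (h : z.re ≤ w.re) {t : ℝ} (ht : 0 ≤ t) :
    ‖momentIntegrand k w t‖ ≤ ‖momentIntegrand k z t‖ := by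
  rw [norm_momentIntegrand, norm_momentIntegrand]
  gcongr

theorem integrableOn_momentIntegrand (k : ℕ) (z : ℂ) :
    IntegrableOn (momentIntegrand k z) (Ioi 0) := by
  -- The power is absorbed by `t ^ k ≤ k! * exp t`, which only shifts the linear coefficient by 1.
  have h := ((integrable_cexp_quadratic' (b := -1 / 2) (by norm_num) (-z + 1) 0).norm.const_mul
    (k.factorial : ℝ)).integrableOn (s := Ioi 0)
  refine Integrable.mono' h (continuous_momentIntegrand k z).aestronglyMeasurable ?_
  filter_upwards [ae_restrict_mem measurableSet_Ioi] with t ht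
  have ht : 0 < t := ht
  have e : Complex.exp (-1 / 2 * (t : ℂ) ^ 2 + (-z + 1) * t + 0)
      = Complex.exp (t : ℂ) * Complex.exp (-z * t - (t : ℂ) ^ 2 / 2) := by
    rw [← Complex.exp_add]
    ring_nf
  have hk : ‖(t : ℂ) ^ k‖ ≤ k.factorial * Real.exp t := by
    have := Real.pow_div_factorial_le_exp t ht.le k
    rw [div_le_iff₀ (by positivity)] at this
    rw [norm_pow, Complex.norm_real, Real.norm_of_nonneg ht.le]
    linarith
  rw [e, norm_mul, momentIntegrand, norm_mul, ← mul_assoc, Complex.norm_exp_ofReal]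
  gcongr

theorem hasDerivAt_moment (k : ℕ) (z : ℂ) : HasDerivAt (moment k) (-moment (k + 1) z) z := by
  have h := (hasDerivAt_integral_of_dominated_loc_of_deriv_le (𝕜 := ℂ)
    (μ := volume.restrict (Ioi (0 : ℝ))) (F := momentIntegrand k)
    (F' := fun w t => -momentIntegrand (k + 1) w t) (x₀ := z) (s := Metric.ball z 1)
    -- Points of the unit ball about `z` have real part at least `z.re - 1`.
    (bound := fun t => ‖momentIntegrand (k + 1) (z - 1) t‖)
    (Metric.ball_mem_nhds z one_pos)
    (Eventually.of_forall fun w => (continuous_momentIntegrand k w).aestronglyMeasurable)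
    (integrableOn_momentIntegrand k z)
    (continuous_momentIntegrand (k + 1) z).neg.aestronglyMeasurable
    (by
      filter_upwards [ae_restrict_mem measurableSet_Ioi] with t ht w hw
      rw [norm_neg]
      refine norm_momentIntegrand_le _ ?_ (le_of_lt ht)
      have h1 := Complex.abs_re_le_norm (w - z)
      rw [Metric.mem_ball, dist_eq_norm] at hw
      have h2 := (abs_lt.1 (h1.trans_lt hw)).1
      simp only [Complex.sub_re, Complex.one_re] at h2 ⊢
      linarith)
    (integrableOn_momentIntegrand (k + 1) (z - 1)).norm
    (by
      refine Eventually.of_forall fun t w _ => ?_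
      have h1 : HasDerivAt (fun w : ℂ => -w * t - (t : ℂ) ^ 2 / 2) (-1 * (t : ℂ)) w :=
        (((hasDerivAt_id w).neg.mul_const (t : ℂ)).sub_const ((t : ℂ) ^ 2 / 2))
      refine (h1.cexp.const_mul ((t : ℂ) ^ k)).congr_deriv ?_
      simp only [momentIntegrand]
      ring)).2
  rw [integral_neg] at h
  exact h

theorem norm_moment_le (k : ℕ) {z : ℂ} (hz : 0 ≤ z.re) :
    ‖moment k z‖ ≤ ∫ t in Ioi (0 : ℝ), ‖momentIntegrand k 0 t‖ := by
  refine (norm_integral_le_integral_norm _).trans ?_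
  refine setIntegral_mono_on (integrableOn_momentIntegrand k z).norm
    (integrableOn_momentIntegrand k 0).norm measurableSet_Ioi fun t ht => ?_
  exact norm_momentIntegrand_le k (by simpa using hz) (le_of_lt ht)

/-- There is no boundary term at infinity: a function that is integrable together with its
derivative tends to 0. -/
theorem integral_eq_neg_momentIntegrand (k : ℕ) {z : ℂ} {f' : ℝ → ℂ}
    (h : ∀ t : ℝ, HasDerivAt (momentIntegrand k z) (f' t) t) (hi : IntegrableOn f' (Ioi 0)) :
    ∫ t in Ioi (0 : ℝ), f' t = -momentIntegrand k z 0 := by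
  rw [integral_Ioi_of_hasDerivAt_of_tendsto' (fun t _ => h t) hi
    (tendsto_zero_of_hasDerivAt_of_integrableOn_Ioi (fun t _ => h t) hi
      (integrableOn_momentIntegrand k z)), zero_sub]

theorem hasDerivAt_exponential (z : ℂ) (t : ℝ) :
    HasDerivAt (fun t : ℝ => Complex.exp (-z * t - (t : ℂ) ^ 2 / 2))
      (-(z + t) * Complex.exp (-z * t - (t : ℂ) ^ 2 / 2)) t := by
  have h1 : HasDerivAt (fun t : ℂ => -z * t - t ^ 2 / 2) (-z - t) (t : ℂ) := by
    have := ((hasDerivAt_id (t : ℂ)).const_mul (-z)).sub ((hasDerivAt_pow 2 (t : ℂ)).div_const 2)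
    refine this.congr_deriv ?_
    simp
  refine (h1.cexp.comp_ofReal).congr_deriv ?_
  ring

theorem mul_moment_zero (z : ℂ) : z * moment 0 z = 1 - moment 1 z := by
  have hz := (integrableOn_momentIntegrand 0 z).const_mul z
  have h1 := integrableOn_momentIntegrand 1 z
  have h := integral_eq_neg_momentIntegrand 0 (z := z)
    (f' := fun t => -(z * momentIntegrand 0 z t + momentIntegrand 1 z t))
    (fun t => by
      have e : momentIntegrand 0 z =
          fun t : ℝ => Complex.exp (-z * t - (t : ℂ) ^ 2 / 2) := by
        funext y
        simp [momentIntegrand]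
      rw [e]
      refine (hasDerivAt_exponential z t).congr_deriv ?_
      simp only [momentIntegrand]
      ring)
    (hz.add h1).neg
  have h0 : momentIntegrand 0 z 0 = 1 := by simp [momentIntegrand]
  rw [integral_neg, integral_add hz h1, integral_const_mul, h0] at h
  simp only [moment]
  linear_combination -h

theorem mul_moment_one (z : ℂ) : z * moment 1 z = moment 0 z - moment 2 z := by
  have hz := (integrableOn_momentIntegrand 1 z).const_mul z
  have h2 := integrableOn_momentIntegrand 2 z
  have hs : IntegrableOn (fun t => z * momentIntegrand 1 z t + momentIntegrand 2 z t) (Ioi 0) :=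
    hz.add h2
  have h := integral_eq_neg_momentIntegrand 1 (z := z)
    (f' := fun t => momentIntegrand 0 z t - (z * momentIntegrand 1 z t + momentIntegrand 2 z t))
    (fun t => by
      have := ((hasDerivAt_id (t : ℂ)).comp_ofReal).fun_mul (hasDerivAt_exponential z t)
      have e : momentIntegrand 1 z =
          fun t : ℝ => id (t : ℂ) * Complex.exp (-z * t - (t : ℂ) ^ 2 / 2) := by
        funext y
        simp [momentIntegrand]
      rw [e]
      refine this.congr_deriv ?_
      simp only [momentIntegrand, id]
      ring)
    ((integrableOn_momentIntegrand 0 z).sub hs)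
  have h0 : momentIntegrand 1 z 0 = 0 := by simp [momentIntegrand]
  rw [integral_sub (integrableOn_momentIntegrand 0 z) hs, integral_add hz h2,
    integral_const_mul, h0] at h
  simp only [moment]
  linear_combination -h

/-! ### The Mills ratio as a moment -/

theorem hasDerivAt_phi (z : ℂ) : HasDerivAt phi (-z * phi z) z := by
  have h1 : HasDerivAt (fun t : ℂ => -t ^ 2 / 2) (-z) z := by
    refine ((hasDerivAt_pow 2 z).neg.div_const 2).congr_deriv ?_
    simp
    ring
  refine (h1.cexp.const_mul _).congr_deriv ?_
  rw [phi]
  ring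

theorem phi_ne_zero (z : ℂ) : phi z ≠ 0 := by
  have : Real.sqrt (2 * Real.pi) ≠ 0 := by positivity
  exact mul_ne_zero (Complex.ofReal_ne_zero.2 (one_div_ne_zero this)) (Complex.exp_ne_zero _)

/-- By `mul_moment_zero` the difference of the two sides has zero derivative, and it vanishes at 0.
-/
theorem tail_eq (z : ℂ) : tail z = phi z * moment 0 z := by
  have hd : ∀ w, HasDerivAt (fun w => tail w - phi w * moment 0 w) 0 w := fun w => by
    refine ((hasDerivAt_tail w).sub ((hasDerivAt_phi w).mul (hasDerivAt_moment 0 w))).congr_deriv ?_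
    linear_combination phi w * mul_moment_zero w
  have h := is_const_of_deriv_eq_zero (fun w => (hd w).differentiableAt) (fun w => (hd w).deriv) z 0
  have h0 : tail 0 = phi 0 * moment 0 0 := by
    simp only [tail, zero_mul, sub_zero, moment, ← integral_const_mul]
    congr 1
    funext t
    simp only [phi, momentIntegrand]
    rw [show (0 : ℂ) ^ 2 = 0 by norm_num]
    simp [neg_div]
  rw [h0, sub_self, sub_eq_zero] at h
  exact h

/-! ### Values on the imaginary axis -/

theorem integral_phi_Ioi : ∫ u in Ioi (0 : ℝ), phi (u : ℂ) = 1 / 2 := by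
  have e : ∀ u : ℝ, phi (u : ℂ)
      = ((1 / Real.sqrt (2 * Real.pi) * Real.exp (-(1 / 2) * u ^ 2) : ℝ) : ℂ) := fun u => by
    rw [phi]
    push_cast
    ring_nf
  simp_rw [e]
  rw [integral_complex_ofReal, integral_const_mul, integral_gaussian_Ioi]
  have : Real.pi / (1 / 2) = 2 * Real.pi := by ring
  have h2 : Real.sqrt (2 * Real.pi) ≠ 0 := by positivity
  rw [this]
  push_cast
  field_simp

/-- The integral `∫_0^1 e^{t²y²/2} dt`. -/
noncomputable def integralExpSq (y : ℝ) : ℝ := ∫ t in (0 : ℝ)..1, Real.exp (t ^ 2 * y ^ 2 / 2)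

/-- Write `exp (y ^ 2 / 2) - 1` as the integral of the derivative of `exp (t ^ 2 * y ^ 2 / 2)` over
[0, 1] and bound the factor `t` by 1. -/
theorem exp_sq_half_lt {y : ℝ} (hy : y ≠ 0) : Real.exp (y ^ 2 / 2) < 1 + y ^ 2 * integralExpSq y := by
  have hy2 : 0 < y ^ 2 := by positivity
  have h1 : ∫ t in (0 : ℝ)..1, t * y ^ 2 * Real.exp (t ^ 2 * y ^ 2 / 2)
      = Real.exp (y ^ 2 / 2) - 1 := by
    rw [intervalIntegral.integral_eq_sub_of_hasDerivAt
      (f := fun t => Real.exp (t ^ 2 * y ^ 2 / 2))]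
    · simp
    · intro t _
      have h : HasDerivAt (fun t : ℝ => t ^ 2 * y ^ 2 / 2) (t * y ^ 2) t := by
        refine (((hasDerivAt_pow 2 t).mul_const (y ^ 2)).div_const 2).congr_deriv ?_
        simp
        ring
      exact h.exp.congr_deriv (by ring)
    · exact (by fun_prop : Continuous _).intervalIntegrable _ _
  have h2 : ∫ t in (0 : ℝ)..1, t * y ^ 2 * Real.exp (t ^ 2 * y ^ 2 / 2)
      < ∫ t in (0 : ℝ)..1, y ^ 2 * Real.exp (t ^ 2 * y ^ 2 / 2) := by
    refine intervalIntegral.integral_lt_integral_of_continuousOn_of_le_of_exists_lt one_pos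
      (by fun_prop) (by fun_prop) (fun t ht => ?_) ⟨0, by simp, ?_⟩
    · have := Real.exp_pos (t ^ 2 * y ^ 2 / 2)
      have := ht.2
      gcongr
      nlinarith
    · simpa using hy2
  rw [h1, intervalIntegral.integral_const_mul] at h2
  simp only [integralExpSq]
  linarith

theorem phi_ofReal_mul_I (y : ℝ) : phi (y * Complex.I)
    = ((1 / Real.sqrt (2 * Real.pi) * Real.exp (y ^ 2 / 2) : ℝ) : ℂ) := by
  have : -(y * Complex.I) ^ 2 / 2 = ((y ^ 2 / 2 : ℝ) : ℂ) := by
    rw [mul_pow, Complex.I_sq]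
    push_cast
    ring
  rw [phi, this, ← Complex.ofReal_exp, Complex.ofReal_mul]

theorem tail_ofReal_mul_I (y : ℝ) : tail (y * Complex.I)
    = ((1 / 2 : ℝ) : ℂ)
      - ((1 / Real.sqrt (2 * Real.pi) * (y * integralExpSq y) : ℝ) : ℂ) * Complex.I := by
  have h : ∀ t : ℝ, phi (t * (y * Complex.I))
      = ((1 / Real.sqrt (2 * Real.pi) * Real.exp (t ^ 2 * y ^ 2 / 2) : ℝ) : ℂ) := fun t => by
    rw [← mul_assoc, ← Complex.ofReal_mul, phi_ofReal_mul_I, mul_pow]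
  rw [tail, integral_phi_Ioi]
  simp_rw [h]
  rw [intervalIntegral.integral_ofReal, intervalIntegral.integral_const_mul]
  simp only [integralExpSq]
  push_cast
  ring

/-! ### Maximum principle and nonvanishing -/

/-- A bounded analytic function on the right half-plane with `‖f‖ ≤ 1` on the imaginary axis,
strictly somewhere on it, satisfies `‖f‖ < 1` in the interior. -/
theorem norm_lt_one_of_bounded {f : ℂ → ℂ} (hd : ∀ z, 0 ≤ z.re → DifferentiableAt ℂ f z)
    {K : ℝ} (hb : ∀ᶠ z in Bornology.cobounded ℂ ⊓ 𝓟 rightHalfPlane, ‖f z‖ ≤ K)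
    (him : ∀ y : ℝ, ‖f (y * Complex.I)‖ ≤ 1) {y₀ : ℝ} (hy₀ : ‖f (y₀ * Complex.I)‖ < 1)
    {z : ℂ} (hz : 0 < z.re) : ‖f z‖ < 1 := by
  have hcl : DiffContOnCl ℂ f {z | 0 < z.re} := by
    refine DifferentiableOn.diffContOnCl fun w hw => ?_
    rw [Complex.closure_setOfPred_lt_re] at hw
    exact (hd w hw).differentiableWithinAt
  have hle : ∀ w : ℂ, 0 ≤ w.re → ‖f w‖ ≤ 1 := fun w hw => by
    refine PhragmenLindelof.right_half_plane_of_bounded_on_real hcl ⟨0, by norm_num, 0, ?_⟩ ?_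
      him hw
    · refine Asymptotics.IsBigO.of_bound K ?_
      have hsub : {z : ℂ | 0 < z.re} ⊆ rightHalfPlane := fun z (hz : 0 < z.re) => hz.le
      filter_upwards [hb.filter_mono (inf_le_inf_left _ (principal_mono.2 hsub))] with w hw
      simpa using hw
    · refine ⟨K, eventually_map.2 ?_⟩
      have ht : Tendsto (fun x : ℝ => (x : ℂ)) atTop
          (Bornology.cobounded ℂ ⊓ 𝓟 rightHalfPlane) := by
        refine tendsto_inf.2 ⟨?_, tendsto_principal.2 ?_⟩
        · rw [← tendsto_norm_atTop_iff_cobounded]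
          simpa using tendsto_abs_atTop_atTop
        · filter_upwards [eventually_ge_atTop 0] with x hx
          simpa [rightHalfPlane] using hx
      exact ht.eventually hb
  refine lt_of_le_of_ne (hle z hz.le) fun heq => ?_
  -- An interior maximum would make the norm constant up to the boundary, contradicting strictness
  -- at `y₀`.
  have h := Complex.norm_eqOn_closure_of_isPreconnected_of_isMaxOn
    (convex_halfSpace_re_gt 0).isPreconnected
    (isOpen_lt continuous_const Complex.continuous_re) hcl hz
    (fun w (hw : 0 < w.re) => by simpa [heq] using hle w hw.le)
  rw [Complex.closure_setOfPred_lt_re] at h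
  have h' := h (show (0 : ℝ) ≤ (y₀ * Complex.I).re by simp)
  simp only [Function.comp_apply, Function.const_apply, heq] at h'
  exact hy₀.ne h'

theorem moment_zero_ofReal_mul_I_re_pos (y : ℝ) : 0 < (moment 0 (y * Complex.I)).re := by
  have h := tail_eq (y * Complex.I)
  rw [tail_ofReal_mul_I, phi_ofReal_mul_I] at h
  have h1 := congrArg Complex.re h
  rw [Complex.re_ofReal_mul] at h1
  have h2 : (0 : ℝ) < 1 / Real.sqrt (2 * Real.pi) * Real.exp (y ^ 2 / 2) := by positivity
  refine pos_of_mul_pos_right (lt_of_lt_of_eq ?_ h1) h2.le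
  simp

theorem moment_zero_re_pos {z : ℂ} (hz : 0 ≤ z.re) : 0 < (moment 0 z).re := by
  have hlt : ∀ y : ℝ, ‖Complex.exp (-moment 0 (y * Complex.I))‖ < 1 := fun y => by
    rw [Complex.norm_exp, Real.exp_lt_one_iff]
    simpa using moment_zero_ofReal_mul_I_re_pos y
  rcases hz.eq_or_lt with h0 | hpos
  · have e : z = z.im * Complex.I := Complex.ext (by simp [← h0]) (by simp)
    rw [e]
    exact moment_zero_ofReal_mul_I_re_pos _
  · have := norm_lt_one_of_bounded (f := fun z => Complex.exp (-moment 0 z))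
      (K := Real.exp (∫ t in Ioi (0 : ℝ), ‖momentIntegrand 0 0 t‖))
      (fun w _ => (hasDerivAt_moment 0 w).differentiableAt.neg.cexp)
      (by
        filter_upwards [mem_inf_of_right (mem_principal_self _)] with w hw
        rw [Complex.norm_exp]
        refine Real.exp_le_exp.2 (le_trans ?_ (norm_moment_le 0 hw))
        rw [← norm_neg]
        exact Complex.re_le_norm _)
      (fun y => (hlt y).le) (hlt 0) hpos
    rw [Complex.norm_exp, Real.exp_lt_one_iff] at this
    simpa using this

theorem tail_ne_zero {z : ℂ} (hz : 0 ≤ z.re) : tail z ≠ 0 := by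
  rw [tail_eq]
  refine mul_ne_zero (phi_ne_zero z) fun h => ?_
  simpa [h] using moment_zero_re_pos hz

theorem R_eq_inv (z : ℂ) : R z = (moment 0 z)⁻¹ := by
  rw [R, tail_eq, div_mul_cancel_left₀ (phi_ne_zero z)]

/-! ### Asymptotics at infinity -/

theorem tendsto_mul_moment_zero : Tendsto (fun z => z * moment 0 z)
    (Bornology.cobounded ℂ ⊓ 𝓟 rightHalfPlane) (𝓝 1) := by
  have h1 : Tendsto (moment 1) (Bornology.cobounded ℂ ⊓ 𝓟 rightHalfPlane) (𝓝 0) := by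
    have hinv : Tendsto (fun z : ℂ => ‖z‖⁻¹) (Bornology.cobounded ℂ ⊓ 𝓟 rightHalfPlane) (𝓝 0) :=
      (tendsto_inv_atTop_zero.comp tendsto_norm_cobounded_atTop).mono_left inf_le_left
    have hK := hinv.mul_const ((∫ t in Ioi (0 : ℝ), ‖momentIntegrand 0 0 t‖)
      + ∫ t in Ioi (0 : ℝ), ‖momentIntegrand 2 0 t‖)
    rw [zero_mul] at hK
    refine squeeze_zero_norm' ?_ hK
    filter_upwards [mem_inf_of_right (mem_principal_self _),
      mem_inf_of_left (Bornology.eventually_ne_cobounded (0 : ℂ))] with w hw hw0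
    have h := congrArg norm (mul_moment_one w)
    rw [norm_mul] at h
    have h2 : ‖w‖ ≠ 0 := norm_ne_zero_iff.2 hw0
    rw [← div_eq_inv_mul, le_div_iff₀' (by positivity), h]
    exact (norm_sub_le _ _).trans (add_le_add (norm_moment_le 0 hw) (norm_moment_le 2 hw))
  simpa [mul_moment_zero] using h1.const_sub 1

theorem tendsto_R_div : Tendsto (fun z => R z / z)
    (Bornology.cobounded ℂ ⊓ 𝓟 rightHalfPlane) (𝓝 1) := by
  have h := tendsto_mul_moment_zero.inv₀ one_ne_zero
  rw [inv_one] at h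
  refine h.congr fun z => ?_
  rw [R_eq_inv, mul_inv, mul_comm, div_eq_mul_inv]

/-! ### The strict bound -/

theorem R_zero : R 0 = ((Real.sqrt (2 / Real.pi) : ℝ) : ℂ) := by
  have h1 : tail 0 = 1 / 2 := by rw [tail, zero_mul, sub_zero, integral_phi_Ioi]
  have h2 : phi 0 = ((1 / Real.sqrt (2 * Real.pi) : ℝ) : ℂ) := by simp [phi]
  have h3 : Real.sqrt (2 / Real.pi) = 2 * (1 / Real.sqrt (2 * Real.pi)) := by
    rw [Real.sqrt_div (by norm_num), Real.sqrt_mul (by norm_num)]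
    have := Real.mul_self_sqrt (show (0 : ℝ) ≤ 2 by norm_num)
    have := Real.sqrt_pos.2 Real.pi_pos
    field_simp
    linarith
  rw [R, h1, h2, h3]
  push_cast
  ring

theorem norm_R_ofReal_mul_I_lt {y : ℝ} (hy : y ≠ 0) :
    ‖R (y * Complex.I)‖ < ‖y * Complex.I + ((Real.sqrt (2 / Real.pi) : ℝ) : ℂ)‖ := by
  have ht : 0 < ‖tail (y * Complex.I)‖ := norm_pos_iff.2 (tail_ne_zero (by simp))
  rw [R, norm_div, div_lt_iff₀ ht, ← sq_lt_sq₀ (by positivity) (by positivity), mul_pow,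
    phi_ofReal_mul_I, tail_ofReal_mul_I, Complex.norm_real, Real.norm_eq_abs, sq_abs,
    Complex.sq_norm, Complex.sq_norm, Complex.normSq_apply, Complex.normSq_apply]
  simp only [Complex.add_re, Complex.add_im, Complex.sub_re, Complex.sub_im, Complex.re_ofReal_mul,
    Complex.im_ofReal_mul, Complex.ofReal_re, Complex.ofReal_im, Complex.I_re, Complex.I_im]
  have h := exp_sq_half_lt hy
  have hE := Real.exp_pos (y ^ 2 / 2)
  set E := Real.exp (y ^ 2 / 2)
  set J := integralExpSq y
  set k := 1 / Real.sqrt (2 * Real.pi)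
  set c := Real.sqrt (2 / Real.pi)
  have hk : 0 < k := by positivity
  have hc : c = 2 * k := by
    have := R_zero
    have h1 : tail 0 = 1 / 2 := by rw [tail, zero_mul, sub_zero, integral_phi_Ioi]
    have h2 : phi 0 = (k : ℂ) := by simp [phi, k]
    rw [R, h1, h2] at this
    have h3 : ((2 * k : ℝ) : ℂ) = (c : ℂ) := by
      rw [← this]
      push_cast
      ring
    exact_mod_cast h3.symm
  have h1 : E ^ 2 < (1 + y ^ 2 * J) ^ 2 := by gcongr
  have h2 : k ^ 2 * E ^ 2 < k ^ 2 * (1 + y ^ 2 * J) ^ 2 := by gcongr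
  rw [hc]
  -- The right side minus `k² (1 + y² J)²` is exactly this square; `c = 2k` makes the constant terms
  -- cancel.
  nlinarith [sq_nonneg (y / 2 - 2 * k * (k * (y * J)))]

theorem norm_R_lt {z : ℂ} (hz : 0 ≤ z.re) (h0 : z ≠ 0) :
    ‖R z‖ < ‖z + ((Real.sqrt (2 / Real.pi) : ℝ) : ℂ)‖ := by
  set c := Real.sqrt (2 / Real.pi)
  have hc : 0 < c := by positivity
  have hne : ∀ w : ℂ, 0 ≤ w.re → w + (c : ℂ) ≠ 0 := fun w hw h => by
    have := congrArg Complex.re h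
    simp at this
    linarith
  rcases hz.eq_or_lt with hr | hpos
  · have e : z = z.im * Complex.I := Complex.ext (by simp [← hr]) (by simp)
    have hy : z.im ≠ 0 := fun h => h0 (by rw [e, h]; simp)
    rw [e]
    exact norm_R_ofReal_mul_I_lt hy
  have hpos' : ∀ w : ℂ, 0 ≤ w.re → 0 < ‖w + (c : ℂ)‖ := fun w hw => norm_pos_iff.2 (hne w hw)
  have hlt : ∀ y : ℝ, y ≠ 0 → ‖R (y * Complex.I) / (y * Complex.I + c)‖ < 1 := fun y hy => by
    rw [norm_div, div_lt_one (hpos' _ (by simp))]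
    exact norm_R_ofReal_mul_I_lt hy
  -- Any `K > 1` would do, since `R w / w → 1` and `‖w‖ ≤ ‖w + c‖`. Equality holds at 0, so
  -- strictness is taken at `y₀ = 1`.
  have := norm_lt_one_of_bounded (f := fun z => R z / (z + c)) (K := 2) (y₀ := 1)
    (fun w hw => ((differentiable_phi w).div (hasDerivAt_tail w).differentiableAt
      (tail_ne_zero hw)).div (by fun_prop) (hne w hw))
    (by
      filter_upwards [tendsto_R_div.norm.eventually_le_const (u := 2) (by simp),
        mem_inf_of_right (mem_principal_self _),
        mem_inf_of_left (Bornology.eventually_ne_cobounded (0 : ℂ))] with w hw hre hw0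
      refine le_trans ?_ hw
      have hwp : 0 < ‖w‖ := norm_pos_iff.2 hw0
      rw [norm_div, norm_div]
      gcongr
      rw [← sq_le_sq₀ (norm_nonneg _) (norm_nonneg _), Complex.sq_norm, Complex.sq_norm,
        Complex.normSq_apply, Complex.normSq_apply]
      have hre : 0 ≤ w.re := hre
      simp only [Complex.add_re, Complex.add_im, Complex.ofReal_re, Complex.ofReal_im]
      nlinarith [mul_nonneg hre hc.le])
    (fun y => by
      rcases eq_or_ne y 0 with rfl | hy
      · simp only [Complex.ofReal_zero, zero_mul, zero_add, R_zero]
        rw [div_self (Complex.ofReal_ne_zero.2 hc.ne'), norm_one]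
      · exact (hlt y hy).le)
    (hlt 1 one_ne_zero) hpos
  rwa [norm_div, div_lt_one (hpos' z hz)] at this

end InverseMills

theorem corollary3 :
    (∀ z ∈ InverseMills.rightHalfPlane, InverseMills.tail z ≠ 0) ∧
    (∀ z ∈ InverseMills.rightHalfPlane, z ≠ 0 →
      ‖InverseMills.R z‖ < ‖z + ((Real.sqrt (2 / Real.pi) : ℝ) : ℂ)‖) ∧
    InverseMills.R 0 = ((Real.sqrt (2 / Real.pi) : ℝ) : ℂ) ∧
    Filter.Tendsto (fun z : ℂ => InverseMills.R z / z)
      (Bornology.cobounded ℂ ⊓ Filter.principal InverseMills.rightHalfPlane) (nhds 1) :=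
  ⟨fun _ hz => InverseMills.tail_ne_zero hz, fun _ hz h0 => InverseMills.norm_R_lt hz h0,
    InverseMills.R_zero, InverseMills.tendsto_R_div⟩
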